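/- Let $V$ be a finite set. For a directed acyclic graph (DAG) $G$ on $V$, write $\mathrm{pa}_G(v)$ for the set of parents of $v$; call $A\subseteq V$ ancestral in $G$ if $\mathrm{pa}_G(v)\subseteq A$ for all $v\in A$. The semi-graphoid of $G$ is the set of triples $(A,B,C)$ of subsets of $V$ such that $C$ separates $A$ from $B$ in the moral graph of the subgraph of $G$ induced by the smallest ancestral set containing $A\cup B\cup C$. Two DAGs on $V$ are Markov equivalent if they have the same semi-graphoid; a dagoid on $V$ is a Markov equivalence class $[G]$ of DAGs on $V$, and $\mathfrak D$ denotes the (finite) set of all dagoids on $V$. A set $A\subseteq V$ is ancestral in a dagoid $D$ if it is ancestral in some $G\in D$; let $\mathfrak D_{\mathrm{anc}}(A)$ be the set of dagoids on $V$ in which $A$ is ancestral. For $D\in\mathfrak D_{\mathrm{anc}}(A)$ and any $G\in D$ in which $A$ is ancestral, let $D_A$ be the Markov equivalence class of the induced subgraph $G_A$ (a dagoid on $A$), and let $D_{V\mid A}$ be the Markov equivalence class of the DAG obtained from $G$ by replacing all edges between elements of $A$ by those of a complete DAG on $A$; neither depends on the choices made. A graph law is a probability distribution $\pi$ on $\mathfrak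 D$. It is (dagoid) structurally Markov if for every $A\subseteq V$, when $D\sim\pi$, the random dagoids $D_{V\mid A}$ and $D_A$ are conditionally independent given the event $D\in\mathfrak D_{\mathrm{anc}}(A)$. The d-clique vector of $D=[G]$ is $$t(D)=\sum_{v\in V}\bigl[\delta(\{v\}\cup\mathrm{pa}_G(v))-\delta(\mathrm{pa}_G(v))\bigr]+\delta(\varnothing)\in\mathbb Z^{2^V},\qquad \delta(A)=(\mathbf 1_{S=A})_{S\subseteq V},$$ which does not depend on the choice of $G\in D$. Theorem. Let $\pi$ be a graph law whose support is all of $\mathfrak D$, i.e. $\pi(D)>0$ for every dagoid $D$ on $V$. Then $\pi$ is structurally Markov if and only if it belongs to the exponential family with the d-clique vector as natural statistic, that is, if and only if there is $\omega\in\mathbb R^{2^V}$ such that $\pi(D)\propto\exp\{\omega\cdot t(D)\}$ for $D\in\mathfrak D$. -/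

import Mathlib

/-- A directed acyclic graph (DAG) with vertex set `V`: a digraph that admits a compatible
well-ordering `r`, i.e. `r u v` holds for every arrow `u → v`. -/
structure Dag (V : Type*) extends Digraph V where
  acyclic : ∃ r : V → V → Prop, IsWellOrder V r ∧ ∀ u v, Adj u v → r u v

namespace Dag

variable {V : Type*}

/-- The set of parents of a vertex. -/
def parents (G : Dag V) (v : V) : Set V := {u | G.Adj u v}

/-- A set of vertices is ancestral if it contains all parents of its elements. -/
def IsAncestral (G : Dag V) (A : Set V) : Prop := ∀ v ∈ A, G.parents v ⊆ A

/-- The smallest ancestral set that contains `B`. -/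
def ancestralHull (G : Dag V) (B : Set V) : Set V := ⋂₀ {U | G.IsAncestral U ∧ B ⊆ U}

/-- The moral graph of the subgraph of `G` induced by `U`: two distinct vertices of `U` are joined
if there is an arrow between them or if they have a common child in `U`. It is regarded as a graph
on all of `V`, in which the vertices outside `U` are isolated. -/
def moralOn (G : Dag V) (U : Set V) : SimpleGraph V where
  Adj u v := u ≠ v ∧ u ∈ U ∧ v ∈ U ∧
    (G.Adj u v ∨ G.Adj v u ∨ ∃ w ∈ U, G.Adj u w ∧ G.Adj v w)
  symm := ⟨fun u v ⟨hne, hu, hv, h⟩ => ⟨hne.symm, hv, hu, by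
    rcases h with h | h | ⟨w, hw, h₁, h₂⟩
    · exact Or.inr (Or.inl h)
    · exact Or.inl h
    · exact Or.inr (Or.inr ⟨w, hw, h₂, h₁⟩)⟩⟩
  loopless := ⟨fun _ h => h.1 rfl⟩

end Dag

/-- `C` separates `A` from `B` in an undirected graph: every path (of any length, zero included)
from an element of `A` to an element of `B` contains an element of `C`. -/
def SimpleGraph.SeparatedBy {V : Type*} (G : SimpleGraph V) (A B C : Set V) : Prop :=
  ∀ a ∈ A, ∀ b ∈ B, ∀ p : G.Walk a b, ∃ c ∈ C, c ∈ p.support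

namespace Dag

variable {V : Type*}

/-- The semi-graphoid of a DAG: the triples `(A, B, C)`, meaning `A ⊥ B | C`, such that `C`
separates `A` from `B` in the moral graph of the subgraph induced by the smallest ancestral set
containing `A ∪ B ∪ C`. -/
def semigraphoid (G : Dag V) : Set (Set V × Set V × Set V) :=
  {T | (G.moralOn (G.ancestralHull (T.1 ∪ T.2.1 ∪ T.2.2))).SeparatedBy T.1 T.2.1 T.2.2}

/-- Markov equivalence of DAGs: equality of their semi-graphoids. -/
instance markovSetoid (V : Type*) : Setoid (Dag V) := Setoid.ker semigraphoid

/-- The induced subgraph on `A`. -/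
def induce (G : Dag V) (A : Set V) : Dag A where
  Adj u v := G.Adj u v
  acyclic := by
    obtain ⟨r, hr, h⟩ := G.acyclic
    exact ⟨Subrel r (· ∈ A), inferInstance, fun u v huv => h u v huv⟩

/-- A complete DAG on `V`, with exactly one arrow between any two distinct vertices (all complete
DAGs on `V` are Markov equivalent). -/
noncomputable def complete (V : Type*) : Dag V where
  Adj u v := WellOrderingRel u v
  acyclic := ⟨WellOrderingRel, inferInstance, fun _ _ h => h⟩

open Classical in
/-- The insertion of a DAG `H` on `A` into a DAG `G` in which `A` is ancestral: the arrows between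
elements of `A` are those of `H`, all other arrows are those of `G`. -/
noncomputable def insertion {A : Set V} (H : Dag A) (G : Dag V) (hA : G.IsAncestral A) : Dag V where
  Adj u v := (∃ (hu : u ∈ A) (hv : v ∈ A), H.Adj ⟨u, hu⟩ ⟨v, hv⟩) ∨
    (G.Adj u v ∧ ¬ (u ∈ A ∧ v ∈ A))
  acyclic := by
    obtain ⟨r, hr, hG⟩ := G.acyclic
    obtain ⟨s, hs, hH⟩ := H.acyclic
    let f : V → A ⊕ V := fun v => if h : v ∈ A then Sum.inl ⟨v, h⟩ else Sum.inr v
    have hf : Function.Injective f := by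
      intro u v huv
      by_cases hu : u ∈ A <;> by_cases hv : v ∈ A <;> simp_all [f]
    refine ⟨f ⁻¹'o Sum.Lex s r, (RelEmbedding.preimage ⟨f, hf⟩ (Sum.Lex s r)).isWellOrder, ?_⟩
    rintro u v (⟨hu, hv, h⟩ | ⟨h, hn⟩)
    · simpa [f, hu, hv] using hH _ _ h
    · by_cases hv : v ∈ A
      · exact absurd ⟨hA v hv h, hv⟩ hn
      · by_cases hu : u ∈ A
        · simp [f, hu, hv]
        · simpa [f, hu, hv] using hG _ _ h

open Classical in
/-- The d-clique vector `∑ᵥ (δ({v} ∪ pa(v)) - δ(pa(v))) + δ(∅)`, where `δ(A)` is the indicator of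
the coordinate `A`. -/
noncomputable def dCliqueVector [Fintype V] (G : Dag V) : Set V → ℤ :=
  ∑ v, (Pi.single (insert v (G.parents v)) 1 - Pi.single (G.parents v) 1) + Pi.single ∅ 1

end Dag

/-- A dagoid: a Markov equivalence class of DAGs on `V`. -/
def Dagoid (V : Type*) : Type _ := Quotient (Dag.markovSetoid V)

namespace Dagoid

variable {V : Type*}

/-- The Markov equivalence class of a DAG. -/
def mk (G : Dag V) : Dagoid V := Quotient.mk _ G

/-- Every set of dagoids is an event. -/
instance : MeasurableSpace (Dagoid V) := ⊤

/-- The set of dagoids in which `A` is ancestral, i.e. ancestral in some DAG of the class. -/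
def ances (A : Set V) : Set (Dagoid V) := {D | ∃ G : Dag V, mk G = D ∧ G.IsAncestral A}

/-- A member of the class `D` in which `A` is ancestral. -/
noncomputable def rep {A : Set V} (D : ances A) : Dag V := D.2.choose

theorem isAncestral_rep {A : Set V} (D : ances A) : (rep D).IsAncestral A := D.2.choose_spec.2

/-- The subdagoid `D_A` induced by an ancestral set `A`: the class of `G_A`, for a member `G` of
`D` in which `A` is ancestral (the class does not depend on `G`). -/
noncomputable def induced {A : Set V} (D : ances A) : Dagoid A := mk ((rep D).induce A)

/-- The remainder dagoid `D_{V|A}`: the class of the insertion of a complete DAG on `A` into `G`,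
for a member `G` of `D` in which `A` is ancestral (the class does not depend on `G`). -/
noncomputable def remainder {A : Set V} (D : ances A) : Dagoid V :=
  mk ((Dag.complete A).insertion (rep D) (isAncestral_rep D))

/-- The d-clique vector of a dagoid: that of a member (it is the same for all members). -/
noncomputable def dCliqueVector [Fintype V] (D : Dagoid V) : Set V → ℤ :=
  (Quotient.out D).dCliqueVector

end Dagoid

open ProbabilityTheory in
/-- The dagoid structural Markov property of a graph law: for every set `A` of vertices, `D_{V|A}`
and `D_A` are independent conditionally on the event that `A` is ancestral in `D`. The conditional
law given this event is regarded as a law on the event. -/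
def IsStructurallyMarkov {V : Type*} (law : PMF (Dagoid V)) : Prop :=
  ∀ A : Set V,
    IndepFun (Dagoid.remainder (A := A)) (Dagoid.induced (A := A))
      ((law.toMeasure[|Dagoid.ances A]).comap Subtype.val)

/-- Membership in the exponential family with the d-clique vector as natural statistic: the
density (with respect to counting measure) is proportional to `exp (ω · t(D))` for some real
vector `ω` indexed by the subsets of `V`. -/
def IsDCliqueExponential {V : Type*} [Fintype V] (law : PMF (Dagoid V)) : Prop :=
  ∃ ω : Set V → ℝ, ∃ c : ℝ, 0 < c ∧ ∀ D : Dagoid V,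
    (law D).toReal = c * Real.exp (∑ A, ω A * (D.dCliqueVector A : ℝ))

/-! ### Numberings, ancestral hulls and moral graphs -/

namespace Dag

open Relation

variable {V : Type*}

/-! For a law of full support, the structural Markov property is a cross-product relation: if `A` is
ancestral in `G` and `H`, exchanging their subgraphs on `A` preserves the product of the two masses
(`isStructurallyMarkov_iff_cross_mul`). The exchange permutes the pairs (vertex, parent set), so it
preserves every sum over them, in particular the sum of the two exponents
(`Dag.sum_parents_insertion_add`). Hence the exponential family is structurally Markov.

Conversely, let `v` be childless in `G` and exchange on the complement of `v` with the DAG complete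
on `pa(v)`. This yields `G` without the arrows into `v`, and a complete DAG on `{v} ∪ pa(v)`
(`IsStructurallyMarkov.log_law_eq`). Removing all arrows in this way expresses `log π` as `ω · t`,
where `ω(A)` is the log mass of the dagoid complete on `A` and edgeless elsewhere.

Independence of representatives rests on the characterisation of Markov equivalence by skeleton and
immoralities (`equiv_iff_samePattern`), proved through reversals of covered arrows, each of which
preserves both the semi-graphoid and the d-clique vector. -/

theorem ext_adj {G H : Dag V} (h : ∀ u v, G.Adj u v ↔ H.Adj u v) : G = H := by
  obtain ⟨⟨a⟩, _⟩ := G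
  obtain ⟨⟨b⟩, _⟩ := H
  have : a = b := by
    ext u v
    exact h u v
  subst this
  rfl

theorem ext_parents {G H : Dag V} (h : ∀ v, G.parents v = H.parents v) : G = H :=
  ext_adj fun u v => by simpa [parents] using Set.ext_iff.1 (h v) u

/-- A finite DAG has a numbering of its vertices that increases along every arrow. -/
theorem exists_rank [Finite V] (G : Dag V) : ∃ f : V → ℕ, ∀ u v, G.Adj u v → f u < f v := by
  obtain ⟨r, hr, h⟩ := G.acyclic
  refine ⟨fun v => {u | r u v}.ncard, fun u v huv => Set.ncard_lt_ncard ?_ (Set.toFinite _)⟩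
  have huv := h u v huv
  exact ⟨fun w hw => _root_.trans hw huv, fun hs => irrefl_of r u (hs huv)⟩

/-- The DAG given by a relation along which some numbering of the vertices increases. -/
def ofRank (R : V → V → Prop) (f : V → ℕ) (h : ∀ u v, R u v → f u < f v) : Dag V where
  Adj := R
  acyclic := by
    -- Ties of `f` are broken by an arbitrary well-order, which makes the order total.
    let g : V → ℕ × V := fun v => (f v, v)
    have hg : Function.Injective g := fun u v huv => congrArg Prod.snd huv
    refine ⟨g ⁻¹'o Prod.Lex (· < ·) WellOrderingRel,
      (RelEmbedding.preimage ⟨g, hg⟩ (Prod.Lex (· < ·) WellOrderingRel)).isWellOrder, ?_⟩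
    intro u v huv
    exact Prod.Lex.left _ _ (h u v huv)

theorem irrefl (G : Dag V) (u : V) : ¬ G.Adj u u := fun h => by
  obtain ⟨r, hr, hG⟩ := G.acyclic
  exact irrefl_of r u (hG u u h)

theorem asymm (G : Dag V) {u v : V} (h : G.Adj u v) : ¬ G.Adj v u := fun h' => by
  obtain ⟨r, hr, hG⟩ := G.acyclic
  exact asymm_of r (hG _ _ h) (hG _ _ h')

theorem not_adj_of_adj_of_adj (G : Dag V) {u v w : V} (h : G.Adj u v) (h' : G.Adj v w) :
    ¬ G.Adj w u := fun h'' => by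
  obtain ⟨r, hr, hG⟩ := G.acyclic
  exact asymm_of r (_root_.trans (hG _ _ h) (hG _ _ h')) (hG _ _ h'')

theorem subset_ancestralHull (G : Dag V) (B : Set V) : B ⊆ G.ancestralHull B :=
  Set.subset_sInter fun _ h => h.2

theorem ancestralHull_subset {G : Dag V} {B U : Set V} (hU : G.IsAncestral U) (h : B ⊆ U) :
    G.ancestralHull B ⊆ U :=
  Set.sInter_subset_of_mem ⟨hU, h⟩

theorem isAncestral_ancestralHull (G : Dag V) (B : Set V) :
    G.IsAncestral (G.ancestralHull B) := fun v hv _ hu U hU =>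
  hU.1 v (hv U hU) hu

/-- The moral graph is the union of cliques on the families `{w} ∪ pa(w)`; this form avoids
distinguishing arrows from common children. -/
theorem moralOn_adj_iff (G : Dag V) (U : Set V) (u v : V) :
    (G.moralOn U).Adj u v ↔ u ≠ v ∧ u ∈ U ∧ v ∈ U ∧
      ∃ w ∈ U, u ∈ insert w (G.parents w) ∧ v ∈ insert w (G.parents w) := by
  simp only [moralOn, parents, Set.mem_insert_iff, Set.mem_ofPred_eq]
  constructor
  · rintro ⟨hne, hu, hv, h | h | ⟨w, hw, h₁, h₂⟩⟩
    · exact ⟨hne, hu, hv, v, hv, Or.inr h, Or.inl rfl⟩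
    · exact ⟨hne, hu, hv, u, hu, Or.inl rfl, Or.inr h⟩
    · exact ⟨hne, hu, hv, w, hw, Or.inr h₁, Or.inr h₂⟩
  · rintro ⟨hne, hu, hv, w, hw, rfl | h₁, rfl | h₂⟩
    · exact absurd rfl hne
    · exact ⟨hne, hu, hv, Or.inr (Or.inl h₂)⟩
    · exact ⟨hne, hu, hv, Or.inl h₁⟩
    · exact ⟨hne, hu, hv, Or.inr (Or.inr ⟨w, hw, h₁, h₂⟩)⟩

theorem moralOn_mono (G : Dag V) {U W : Set V} (h : U ⊆ W) : G.moralOn U ≤ G.moralOn W := by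
  intro u v huv
  rw [moralOn_adj_iff] at huv ⊢
  obtain ⟨hne, hu, hv, w, hw, h'⟩ := huv
  exact ⟨hne, h hu, h hv, w, h hw, h'⟩

end Dag

/-- Separation in terms of reachability outside the separating set. -/
theorem SimpleGraph.separatedBy_iff {V : Type*} (M : SimpleGraph V) (A B C : Set V) :
    M.SeparatedBy A B C ↔ ∀ a ∈ A, ∀ b ∈ B, a ∉ C →
      ¬ Relation.ReflTransGen (fun u v => M.Adj u v ∧ v ∉ C) a b := by
  constructor
  · intro h a ha b hb haC hab
    suffices ∃ p : M.Walk a b, ∀ c ∈ p.support, c ∉ C by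
      obtain ⟨p, hp⟩ := this
      obtain ⟨c, hc, hcp⟩ := h a ha b hb p
      exact hp c hcp hc
    clear h hb
    induction hab with
    | refl => exact ⟨.nil, by simpa using haC⟩
    | tail _ h ih =>
      obtain ⟨p, hp⟩ := ih
      refine ⟨p.concat h.1, fun c hc => ?_⟩
      rw [SimpleGraph.Walk.support_concat, List.mem_append, List.mem_singleton] at hc
      rcases hc with hc | rfl
      · exact hp c hc
      · exact h.2
  · intro h a ha b hb p
    by_contra! hp
    have haC : a ∉ C := fun hc => hp a hc p.start_mem_support
    refine h a ha b hb haC ?_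
    clear h ha hb haC
    induction p with
    | nil => exact .refl
    | cons hadj p ih =>
      refine .head ⟨hadj, fun hc => hp _ hc (by simp)⟩ (ih fun c hc hcp => hp c hc ?_)
      simp [hcp]

/-! ### The semi-graphoid determines the skeleton and the immoralities -/

namespace Dag

open Relation

variable {V : Type*}

theorem mem_semigraphoid_iff (G : Dag V) (A B C : Set V) :
    (A, B, C) ∈ G.semigraphoid ↔ ∀ a ∈ A, ∀ b ∈ B, a ∉ C → ¬ ReflTransGen
      (fun u v => (G.moralOn (G.ancestralHull (A ∪ B ∪ C))).Adj u v ∧ v ∉ C) a b :=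
  SimpleGraph.separatedBy_iff _ _ _ _

/-- Two vertices are joined in the skeleton of `G`. -/
def Joined (G : Dag V) (u v : V) : Prop := G.Adj u v ∨ G.Adj v u

/-- An immorality of `G`: arrows `u → w ← v` with `u`, `v` distinct and not joined. -/
def Immorality (G : Dag V) (u w v : V) : Prop :=
  G.Adj u w ∧ G.Adj v w ∧ u ≠ v ∧ ¬ G.Joined u v

/-- Two DAGs have the same skeleton and the same immoralities. -/
def SamePattern (G H : Dag V) : Prop :=
  (∀ u v, G.Joined u v ↔ H.Joined u v) ∧ ∀ u w v, G.Immorality u w v ↔ H.Immorality u w v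

theorem SamePattern.symm {G H : Dag V} (h : G.SamePattern H) : H.SamePattern G :=
  ⟨fun u v => (h.1 u v).symm, fun u w v => (h.2 u w v).symm⟩

theorem notMem_semigraphoid_of_joined {G : Dag V} {u v : V} (h : G.Joined u v) {C : Set V}
    (hu : u ∉ C) (hv : v ∉ C) : ({u}, {v}, C) ∉ G.semigraphoid := by
  rw [mem_semigraphoid_iff]
  intro hs
  have hsub := G.subset_ancestralHull ({u} ∪ {v} ∪ C)
  refine hs u rfl v rfl hu (.single ⟨⟨?_, hsub (by simp), hsub (by simp), ?_⟩, hv⟩)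
  · rintro rfl
    exact G.irrefl u (h.elim id id)
  · exact h.elim Or.inl fun h => Or.inr (Or.inl h)

/-- The vertices numbered no later than both `u` and `v` allow, i.e. up to the maximum, form an
ancestral set that misses every common child. -/
theorem notMem_ancestralHull_pair [Finite V] {G : Dag V} {u v w : V} (hu : G.Adj u w)
    (hv : G.Adj v w) : w ∉ G.ancestralHull {u, v} := by
  obtain ⟨f, hf⟩ := G.exists_rank
  intro hw
  have hle : w ∈ {z | f z ≤ max (f u) (f v)} := by
    refine ancestralHull_subset ?_ ?_ hw
    · exact fun a ha b hb => (hf b a hb).le.trans ha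
    · rintro z (rfl | rfl) <;> simp
  have := max_lt (hf _ _ hu) (hf _ _ hv)
  exact absurd hle (not_le.2 this)

/-- The separator leaves only `u` and `v` in the hull, so a connecting path would need a moral edge
between them, hence a common child inside the hull. -/
theorem mem_semigraphoid_of_not_joined [Finite V] {G : Dag V} {u v : V} (hne : u ≠ v)
    (h : ¬ G.Joined u v) :
    ({u}, {v}, G.ancestralHull {u, v} \ {u, v}) ∈ G.semigraphoid := by
  have hsub := G.subset_ancestralHull {u, v}
  have hU : ({u} : Set V) ∪ {v} ∪ G.ancestralHull {u, v} \ {u, v} = G.ancestralHull {u, v} := by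
    rw [Set.singleton_union]
    exact Set.union_sdiff_cancel hsub
  have hhull : G.ancestralHull (G.ancestralHull {u, v}) = G.ancestralHull {u, v} :=
    (ancestralHull_subset (G.isAncestral_ancestralHull _) subset_rfl).antisymm
      (G.subset_ancestralHull _)
  rw [mem_semigraphoid_iff, hU, hhull]
  rintro a rfl b rfl - hab
  suffices ∀ z, ReflTransGen (fun x y => (G.moralOn (G.ancestralHull {a, b})).Adj x y ∧
      y ∉ G.ancestralHull {a, b} \ {a, b}) a z → z = a from hne (this b hab).symm
  intro z hz
  induction hz with
  | refl => rfl
  | @tail _ c _ hstep ih =>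
    subst ih
    obtain ⟨⟨hne', -, hz, hadj⟩, hC⟩ := hstep
    by_contra hza
    have : c = b := by
      by_contra hzb
      exact hC ⟨hz, by simp [hza, hzb]⟩
    subst this
    rcases hadj with hadj | hadj | ⟨w, hw, h₁, h₂⟩
    · exact h (Or.inl hadj)
    · exact h (Or.inr hadj)
    · exact notMem_ancestralHull_pair h₁ h₂ hw

theorem joined_iff [Finite V] (G : Dag V) (u v : V) :
    G.Joined u v ↔ u ≠ v ∧ ∀ C : Set V, u ∉ C → v ∉ C → ({u}, {v}, C) ∉ G.semigraphoid := by
  constructor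
  · intro h
    refine ⟨?_, fun C => notMem_semigraphoid_of_joined h⟩
    rintro rfl
    exact G.irrefl u (h.elim id id)
  · rintro ⟨hne, h⟩
    by_contra hn
    exact h _ (by simp) (by simp) (mem_semigraphoid_of_not_joined hne hn)

/-- A middle vertex that is a parent of an endpoint lies in the hull, so the path `u - w - v` is
open unless `w ∈ C`. This tells immoralities from other unshielded paths. -/
theorem notMem_semigraphoid_of_adj {G : Dag V} {u v w : V} {C : Set V} (hu : u ∉ C) (hv : v ∉ C)
    (hw : w ∉ C) (huw : G.Joined u w) (hvw : G.Joined v w) (h : G.Adj w u ∨ G.Adj w v) :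
    ({u}, {v}, C) ∉ G.semigraphoid := by
  rw [mem_semigraphoid_iff]
  intro hs
  have hsub := G.subset_ancestralHull ({u} ∪ {v} ∪ C)
  have hanc := G.isAncestral_ancestralHull ({u} ∪ {v} ∪ C)
  have huU := @hsub u (by simp)
  have hvU := @hsub v (by simp)
  have hwU : w ∈ G.ancestralHull ({u} ∪ {v} ∪ C) := h.elim (fun h => hanc u huU h)
    fun h => hanc v hvU h
  refine hs u rfl v rfl hu (.tail (.single (b := w) ⟨⟨?_, huU, hwU, ?_⟩, hw⟩)
    ⟨⟨?_, hwU, hvU, ?_⟩, hv⟩)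
  · rintro rfl
    exact G.irrefl u (huw.elim id id)
  · exact huw.elim Or.inl fun h => Or.inr (Or.inl h)
  · rintro rfl
    exact G.irrefl w (hvw.elim id id)
  · exact hvw.elim (fun h => Or.inr (Or.inl h)) Or.inl

theorem immorality_iff [Finite V] (G : Dag V) (u w v : V) :
    G.Immorality u w v ↔ u ≠ v ∧ ¬ G.Joined u v ∧ G.Joined u w ∧ G.Joined v w ∧
      ∃ C : Set V, u ∉ C ∧ v ∉ C ∧ w ∉ C ∧ ({u}, {v}, C) ∈ G.semigraphoid := by
  constructor
  · rintro ⟨hu, hv, hne, hn⟩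
    exact ⟨hne, hn, Or.inl hu, Or.inl hv, _, by simp, by simp,
      fun hw => notMem_ancestralHull_pair hu hv hw.1, mem_semigraphoid_of_not_joined hne hn⟩
  · rintro ⟨hne, hn, hu, hv, C, huC, hvC, hwC, hC⟩
    have key : ¬ (G.Adj w u ∨ G.Adj w v) := fun h =>
      notMem_semigraphoid_of_adj huC hvC hwC hu hv h hC
    rw [not_or] at key
    exact ⟨hu.resolve_right key.1, hv.resolve_right key.2, hne, hn⟩

theorem samePattern_of_semigraphoid_eq [Finite V] {G H : Dag V}
    (h : G.semigraphoid = H.semigraphoid) : G.SamePattern H := by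
  have hj : ∀ u v, G.Joined u v ↔ H.Joined u v := fun u v => by
    rw [joined_iff, joined_iff, h]
  refine ⟨hj, fun u w v => ?_⟩
  rw [immorality_iff, immorality_iff, h, hj, hj, hj]

/-! ### Reversal of covered arrows -/

/-- `H` arises from `G` by the reversal of the covered arrow `x → y`. -/
structure CoveredFlip (G H : Dag V) (x y : V) : Prop where
  adj : G.Adj x y
  parents_eq_insert : G.parents y = insert x (G.parents x)
  parents_head : H.parents y = G.parents x
  parents_tail : H.parents x = insert y (G.parents x)
  parents_other : ∀ v, v ≠ x → v ≠ y → H.parents v = G.parents v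

theorem CoveredFlip.symm {G H : Dag V} {x y : V} (h : G.CoveredFlip H x y) :
    H.CoveredFlip G y x where
  adj := by
    have : y ∈ H.parents x := by simp [h.parents_tail]
    exact this
  parents_eq_insert := by rw [h.parents_tail, h.parents_head]
  parents_head := h.parents_head.symm
  parents_tail := by rw [h.parents_eq_insert, h.parents_head]
  parents_other v hy hx := (h.parents_other v hx hy).symm

theorem CoveredFlip.isAncestral {G H : Dag V} {x y : V} (h : G.CoveredFlip H x y) {U : Set V}
    (hU : G.IsAncestral U) (hxy : x ∈ U → y ∈ U) : H.IsAncestral U := by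
  intro v hv
  by_cases hx : v = x
  · subst hx
    rw [h.parents_tail]
    exact Set.insert_subset (hxy hv) (hU v hv)
  by_cases hy : v = y
  · subst hy
    rw [h.parents_head]
    have := hU v hv
    rw [h.parents_eq_insert] at this
    exact (Set.subset_insert _ _).trans this
  · rw [h.parents_other v hx hy]
    exact hU v hv

/-- The families of `x` and `y` in `H` are both contained in the family of `y` in `G`. -/
theorem CoveredFlip.moralOn_le {G H : Dag V} {x y : V} (h : G.CoveredFlip H x y) {U : Set V}
    (hxy : x ∈ U → y ∈ U) : H.moralOn U ≤ G.moralOn U := by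
  intro u v huv
  rw [moralOn_adj_iff] at huv ⊢
  obtain ⟨hne, hu, hv, w, hw, h₁, h₂⟩ := huv
  refine ⟨hne, hu, hv, ?_⟩
  by_cases hx : w = x
  · subst hx
    refine ⟨y, hxy hw, ?_⟩
    rw [h.parents_eq_insert, Set.insert_comm, ← h.parents_tail]
    exact ⟨h₁, h₂⟩
  by_cases hy : w = y
  · subst hy
    refine ⟨w, hw, ?_⟩
    rw [h.parents_eq_insert, Set.insert_comm, ← h.parents_head]
    exact ⟨Or.inr h₁, Or.inr h₂⟩
  · rw [h.parents_other w hx hy] at h₁ h₂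
    exact ⟨w, hw, h₁, h₂⟩

/-- A vertex `y` without children in an ancestral set `U`, whose parents form a complete set in the
moral graph on `U`, does not affect reachability between other vertices. -/
theorem reflTransGen_moralOn_insert {G : Dag V} {U C : Set V} {x y : V} (hU : G.IsAncestral U)
    (hx : x ∈ U) (hy : y ∉ U) (hp : G.parents y = insert x (G.parents x)) {a b : V}
    (ha : a ∈ U) (hb : b ∈ U)
    (hab : ReflTransGen (fun u v => (G.moralOn (insert y U)).Adj u v ∧ v ∉ C) a b) :
    ReflTransGen (fun u v => (G.moralOn U).Adj u v ∧ v ∉ C) a b := by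
  have hpU : G.parents y ⊆ U := by
    rw [hp]
    exact Set.insert_subset hx (hU x hx)
  -- `pa(y)` is the family of `x`, already a clique without `y`; a path through `y` can therefore be
  -- shortcut.
  have hcl : ∀ u ∈ G.parents y, ∀ v ∈ G.parents y, u ≠ v → (G.moralOn U).Adj u v := by
    intro u hu v hv hne
    rw [moralOn_adj_iff]
    refine ⟨hne, hpU hu, hpU hv, x, hx, ?_⟩
    rw [← hp]
    exact ⟨hu, hv⟩
  have hstep : ∀ u v, (G.moralOn (insert y U)).Adj u v → v ∈ U →
      (u ∈ U ∧ (G.moralOn U).Adj u v) ∨ (u = y ∧ v ∈ G.parents y) := by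
    intro u v huv hv
    rw [moralOn_adj_iff] at huv
    obtain ⟨hne, hu, -, w, rfl | hw, h₁, h₂⟩ := huv
    · have hv' : v ∈ G.parents w := h₂.resolve_left fun h => hy (h ▸ hv)
      rcases h₁ with rfl | h₁
      · exact Or.inr ⟨rfl, hv'⟩
      · exact Or.inl ⟨hpU h₁, hcl _ h₁ _ hv' hne⟩
    · have huU : u ∈ U := Set.insert_subset hw (hU w hw) h₁
      exact Or.inl ⟨huU, (moralOn_adj_iff _ _ _ _).2 ⟨hne, huU, hv, w, hw, h₁, h₂⟩⟩
  have key : ∀ v, ReflTransGen (fun u v => (G.moralOn (insert y U)).Adj u v ∧ v ∉ C) a v →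
      (v ∈ U ∧ ReflTransGen (fun u v => (G.moralOn U).Adj u v ∧ v ∉ C) a v) ∨
      (v = y ∧ ∃ n ∈ G.parents y,
        ReflTransGen (fun u v => (G.moralOn U).Adj u v ∧ v ∉ C) a n) := by
    intro v hv
    induction hv with
    | refl => exact Or.inl ⟨ha, .refl⟩
    | @tail u w _ huw ih =>
      have hwU : w ∈ insert y U := huw.1.2.2.1
      rcases hwU with rfl | hw
      · rcases ih with ⟨hu, ih⟩ | ⟨rfl, -⟩
        · refine Or.inr ⟨rfl, u, ?_, ih⟩
          rcases hstep w u huw.1.symm hu with h | h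
          · exact absurd h.1 hy
          · exact h.2
        · exact absurd rfl huw.1.1
      · rcases hstep u w huw.1 hw with h | h
        · rcases ih with ⟨hu, ih⟩ | ⟨rfl, -⟩
          · exact Or.inl ⟨hw, ih.tail ⟨h.2, huw.2⟩⟩
          · exact absurd h.1 hy
        · rcases ih with ⟨hu, ih⟩ | ⟨-, n, hn, ih⟩
          · exact absurd (h.1 ▸ hu) hy
          · refine Or.inl ⟨hw, ?_⟩
            by_cases hnw : n = w
            · exact hnw ▸ ih
            · exact ih.tail ⟨hcl n hn w h.2 hnw, huw.2⟩
  rcases key b hab with h | h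
  · exact h.2
  · exact absurd (h.1 ▸ hb) hy

theorem CoveredFlip.semigraphoid_subset {G H : Dag V} {x y : V} (h : G.CoveredFlip H x y) :
    G.semigraphoid ⊆ H.semigraphoid := by
  rintro ⟨A, B, C⟩ hG
  rw [mem_semigraphoid_iff] at hG ⊢
  intro a ha b hb haC hab
  refine hG a ha b hb haC ?_
  set S := A ∪ B ∪ C
  have hSU := G.subset_ancestralHull S
  have hU := G.isAncestral_ancestralHull S
  have ha' : a ∈ G.ancestralHull S := hSU (Or.inl (Or.inl ha))
  have hb' : b ∈ G.ancestralHull S := hSU (Or.inl (Or.inr hb))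
  by_cases hxy : x ∈ G.ancestralHull S → y ∈ G.ancestralHull S
  · have hsub := ancestralHull_subset (h.isAncestral hU hxy) hSU
    refine hab.lift id fun u v huv => ⟨?_, huv.2⟩
    exact h.moralOn_le hxy (H.moralOn_mono hsub huv.1)
  -- Here the hull may grow under the reversal, but at most by `y`, which is childless in the
  -- enlarged set and can be bypassed in `G`.
  · obtain ⟨hx, hy⟩ := Classical.not_imp.1 hxy
    have hxy' : x ∈ insert y (G.ancestralHull S) → y ∈ insert y (G.ancestralHull S) :=
      fun _ => Set.mem_insert _ _
    have hG' : G.IsAncestral (insert y (G.ancestralHull S)) := by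
      rintro v (rfl | hv)
      · rw [h.parents_eq_insert]
        exact (Set.insert_subset hx (hU x hx)).trans (Set.subset_insert _ _)
      · exact (hU v hv).trans (Set.subset_insert _ _)
    have hsub := ancestralHull_subset (h.isAncestral hG' hxy')
      (hSU.trans (Set.subset_insert y _))
    refine reflTransGen_moralOn_insert hU hx hy h.parents_eq_insert ha' hb' ?_
    refine hab.lift id fun u v huv => ⟨?_, huv.2⟩
    exact h.moralOn_le hxy' (H.moralOn_mono hsub huv.1)

theorem CoveredFlip.semigraphoid_eq {G H : Dag V} {x y : V} (h : G.CoveredFlip H x y) :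
    G.semigraphoid = H.semigraphoid :=
  h.semigraphoid_subset.antisymm h.symm.semigraphoid_subset

-- With `P = pa_G(x)`, the terms of `x` and `y` telescope to `δ({x, y} ∪ P) - δ(P)`, which is
-- symmetric in `x` and `y`.
open Classical in
theorem CoveredFlip.dCliqueVector_eq [Fintype V] {G H : Dag V} {x y : V}
    (h : G.CoveredFlip H x y) : G.dCliqueVector = H.dCliqueVector := by
  have hne : x ≠ y := by
    rintro rfl
    exact G.irrefl _ h.adj
  have hy : y ∈ (Finset.univ.erase x : Finset V) := by simp [hne.symm]
  unfold dCliqueVector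
  congr 1
  rw [← Finset.add_sum_erase _ _ (Finset.mem_univ x), ← Finset.add_sum_erase _ _ hy,
    ← Finset.add_sum_erase _ _ (Finset.mem_univ x), ← Finset.add_sum_erase _ _ hy]
  have : ∀ v ∈ (Finset.univ.erase x).erase y, H.parents v = G.parents v := by
    intro v hv
    simp only [Finset.mem_erase, Finset.mem_univ, and_true] at hv
    exact h.parents_other v hv.2 hv.1
  rw [Finset.sum_congr rfl fun v hv => by rw [← this v hv], h.parents_eq_insert, h.parents_head,
    h.parents_tail, Set.insert_comm]
  abel

/-- A covered arrow of a finite DAG can be reversed. -/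
theorem exists_coveredFlip [Finite V] {G : Dag V} {x y : V} (hxy : G.Adj x y)
    (hp : G.parents y = insert x (G.parents x)) : ∃ H, G.CoveredFlip H x y := by
  classical
  obtain ⟨f, hf⟩ := G.exists_rank
  have hne : x ≠ y := by
    rintro rfl
    exact G.irrefl _ hxy
  have hxy' := hf x y hxy
  let P : V → Set V := fun v =>
    if v = x then insert y (G.parents x) else if v = y then G.parents x else G.parents v
  -- Doubling makes room to move `y` down to just before `x`.
  let g : V → ℕ := fun v => if v = x then 2 * f x + 1 else if v = y then 2 * f x else 2 * f v
  have hg : ∀ u v, u ∈ P v → g u < g v := by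
    intro u v huv
    have hux : u ∈ G.parents x → u ≠ x ∧ u ≠ y ∧ f u < f x := by
      intro hu
      refine ⟨?_, ?_, hf _ _ hu⟩
      · rintro rfl
        exact G.irrefl _ hu
      · rintro rfl
        exact G.asymm hxy hu
    by_cases hvx : v = x
    · subst hvx
      rcases (by simpa [P] using huv : u = y ∨ u ∈ G.parents v) with rfl | hu
      · simp [g, hne.symm]
      · obtain ⟨h₁, h₂, h₃⟩ := hux hu
        simp only [g, h₁, h₂, if_true, if_false]
        omega
    by_cases hvy : v = y
    · subst hvy
      obtain ⟨h₁, h₂, h₃⟩ := hux (by simpa [P, hvx] using huv)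
      simp only [g, h₁, h₂, hvx, if_true, if_false]
      omega
    · have hlt := hf u v (by simpa [P, hvx, hvy, parents] using huv)
      by_cases hu : u = x
      · subst hu
        simp only [g, hvx, hvy, if_true, if_false]
        omega
      by_cases huy : u = y
      · subst huy
        simp only [g, hu, hvx, hvy, if_true, if_false]
        omega
      · simp only [g, hu, huy, hvx, hvy, if_false]
        omega
  refine ⟨ofRank (fun u v => u ∈ P v) g hg, hxy, hp, ?_, ?_, ?_⟩
  · ext u
    simp [parents, ofRank, P, hne.symm]
  · ext u
    simp [parents, ofRank, P]
  · intro v hx hy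
    ext u
    simp [parents, ofRank, P, hx, hy]

/-! ### Skeleton and immoralities characterise Markov equivalence -/

/-- Distinct DAGs with the same pattern differ by the orientation of an arrow that is covered in
the first one. -/
theorem SamePattern.exists_covered [Finite V] {G H : Dag V} (h : G.SamePattern H) (hne : G ≠ H) :
    ∃ x y, G.Adj x y ∧ H.Adj y x ∧ G.parents y = insert x (G.parents x) := by
  obtain ⟨f, hf⟩ := G.exists_rank
  let R : V → V → Prop := fun x y => G.Adj x y ∧ H.Adj y x
  have hRy : ∃ y, ∃ x, R x y := by
    by_contra! hn
    have hGH : ∀ u v, G.Adj u v → H.Adj u v := fun u v huv =>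
      ((h.1 u v).1 (Or.inl huv)).resolve_right fun hvu => hn v u ⟨huv, hvu⟩
    refine hne (ext_adj fun u v => ⟨hGH u v, fun huv => ?_⟩)
    exact ((h.1 u v).2 (Or.inl huv)).resolve_right fun hvu => H.asymm huv (hGH v u hvu)
  -- Choose the earliest head `y` of an arrow reversed in `H`, then the latest tail `x`. Any other
  -- parent arrangement gives a mismatched immorality or a directed 3-cycle.
  obtain ⟨y, hy, hymin⟩ := Set.exists_min_image {y | ∃ x, R x y} f (Set.toFinite _) hRy
  obtain ⟨x, hx, hxmax⟩ := Set.exists_max_image {x | R x y} f (Set.toFinite _) hy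
  obtain ⟨hxy, hyx⟩ : R x y := hx
  have hbefore : ∀ z w, G.Adj w z → f z < f y → H.Adj w z := fun z w hwz hz =>
    ((h.1 w z).1 (Or.inl hwz)).resolve_right fun hzw => not_lt.2 (hymin z ⟨w, hwz, hzw⟩) hz
  refine ⟨x, y, hxy, hyx, Set.Subset.antisymm (fun z hz => ?_) (fun z hz => ?_)⟩
  · by_cases hzx : z = x
    · exact Or.inl hzx
    refine Or.inr ?_
    have hj : G.Joined z x := by
      by_contra hn
      exact H.asymm hyx ((h.2 z y x).1 ⟨hz, hxy, hzx, hn⟩).2.1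
    refine hj.resolve_right fun hxz => ?_
    have hzy : H.Adj z y := ((h.1 z y).1 (Or.inl hz)).resolve_right fun hyz =>
      not_lt.2 (hxmax z ⟨hz, hyz⟩) (hf _ _ hxz)
    exact H.not_adj_of_adj_of_adj hzy hyx (hbefore z x hxz (hf _ _ hz))
  · rcases hz with rfl | hz
    · exact hxy
    have hzy : z ≠ y := by
      rintro rfl
      exact G.asymm hxy hz
    have hj : G.Joined z y := by
      by_contra hn
      have hn' : ¬ H.Joined z y := fun h' => hn ((h.1 z y).2 h')
      have := (h.2 z x y).2 ⟨hbefore x z hz (hf _ _ hxy), hyx, hzy, hn'⟩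
      exact G.asymm hxy this.2.1
    exact hj.resolve_right fun hyz => G.not_adj_of_adj_of_adj hz hxy hyz

/-- A function of DAGs that does not change under covered reversals depends only on the skeleton
and the immoralities. -/
theorem SamePattern.apply_eq [Finite V] {α : Type*} (F : Dag V → α)
    (hF : ∀ (G H : Dag V) (x y : V), G.CoveredFlip H x y → F G = F H) {G H : Dag V}
    (h : G.SamePattern H) : F G = F H := by
  -- Each covered reversal lowers the number of arrows on which `G` disagrees with `H`.
  induction hn : {p : V × V | G.Adj p.1 p.2 ∧ ¬ H.Adj p.1 p.2}.ncard using Nat.strong_induction_on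
    generalizing G with
  | _ n ih =>
    by_cases hne : G = H
    · rw [hne]
    obtain ⟨x, y, hxy, hyx, hp⟩ := h.exists_covered hne
    obtain ⟨K, hK⟩ := exists_coveredFlip hxy hp
    rw [hF G K x y hK]
    have hGK := samePattern_of_semigraphoid_eq hK.semigraphoid_eq
    refine ih _ ?_ ⟨fun u v => (hGK.1 u v).symm.trans (h.1 u v),
      fun u w v => (hGK.2 u w v).symm.trans (h.2 u w v)⟩ rfl
    rw [← hn]
    refine Set.ncard_lt_ncard ⟨?_, fun hs => ?_⟩ (Set.toFinite _)
    · rintro ⟨u, v⟩ ⟨huv, hH⟩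
      refine ⟨?_, hH⟩
      have hu : u ∈ K.parents v := huv
      by_cases hvx : v = x
      · subst hvx
        rw [hK.parents_tail] at hu
        rcases hu with rfl | hu
        · exact absurd hyx hH
        · exact hu
      by_cases hvy : v = y
      · subst hvy
        rw [hK.parents_head] at hu
        have : u ∈ G.parents v := hp ▸ Set.mem_insert_of_mem _ hu
        exact this
      · rw [hK.parents_other v hvx hvy] at hu
        exact hu
    · have : K.Adj x y := (@hs (x, y) ⟨hxy, H.asymm hyx⟩).1
      exact K.asymm hK.symm.adj this

/-- Markov equivalence of finite DAGs amounts to equality of skeletons and immoralities. -/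
theorem equiv_iff_samePattern [Finite V] {G H : Dag V} : G ≈ H ↔ G.SamePattern H :=
  ⟨samePattern_of_semigraphoid_eq, fun h => h.apply_eq semigraphoid
    fun _ _ _ _ => CoveredFlip.semigraphoid_eq⟩

theorem dCliqueVector_eq_of_equiv [Fintype V] {G H : Dag V} (h : G ≈ H) :
    G.dCliqueVector = H.dCliqueVector :=
  (equiv_iff_samePattern.1 h).apply_eq dCliqueVector fun _ _ _ _ => CoveredFlip.dCliqueVector_eq

end Dag

/-! ### Insertion on ancestral sets respects Markov equivalence -/

namespace Dag

variable {V : Type*}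

theorem insertion_adj_of_mem {A : Set V} (H : Dag A) (G : Dag V) (hA : G.IsAncestral A) {u v : V}
    (hv : v ∈ A) : (H.insertion G hA).Adj u v ↔ ∃ hu : u ∈ A, H.Adj ⟨u, hu⟩ ⟨v, hv⟩ := by
  constructor
  · rintro (⟨hu, _, h⟩ | ⟨h, hn⟩)
    · exact ⟨hu, h⟩
    · exact absurd ⟨hA v hv h, hv⟩ hn
  · rintro ⟨hu, h⟩
    exact Or.inl ⟨hu, hv, h⟩

theorem insertion_adj_of_notMem {A : Set V} (H : Dag A) (G : Dag V) (hA : G.IsAncestral A)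
    {u v : V} (hv : v ∉ A) : (H.insertion G hA).Adj u v ↔ G.Adj u v := by
  constructor
  · rintro (⟨-, hv', -⟩ | ⟨h, -⟩)
    · exact absurd hv' hv
    · exact h
  · exact fun h => Or.inr ⟨h, fun h' => hv h'.2⟩

theorem isAncestral_insertion {A : Set V} (H : Dag A) (G : Dag V) (hA : G.IsAncestral A) :
    (H.insertion G hA).IsAncestral A := fun _ hv _ hu =>
  ((insertion_adj_of_mem H G hA hv).1 hu).1

theorem insertion_insertion {A : Set V} (H K : Dag A) (G : Dag V) (hA : G.IsAncestral A) :
    H.insertion (K.insertion G hA) (isAncestral_insertion K G hA) = H.insertion G hA := by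
  refine ext_adj fun u v => ?_
  by_cases hv : v ∈ A
  · rw [insertion_adj_of_mem _ _ _ hv, insertion_adj_of_mem _ _ _ hv]
  · rw [insertion_adj_of_notMem _ _ _ hv, insertion_adj_of_notMem _ _ _ hv,
      insertion_adj_of_notMem _ _ _ hv]

theorem insertion_induce_self {A : Set V} (G : Dag V) (hA : G.IsAncestral A) :
    (G.induce A).insertion G hA = G := by
  refine ext_adj fun u v => ?_
  by_cases hv : v ∈ A
  · rw [insertion_adj_of_mem _ _ _ hv]
    exact ⟨fun h => h.2, fun h => ⟨hA v hv h, h⟩⟩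
  · rw [insertion_adj_of_notMem _ _ _ hv]

theorem induce_insertion {A : Set V} (H : Dag A) (G : Dag V) (hA : G.IsAncestral A) :
    (H.insertion G hA).induce A = H := by
  refine ext_adj fun u v => ?_
  refine (insertion_adj_of_mem H G hA v.2).trans ?_
  simp

theorem parents_insertion_induce_of_mem {A : Set V} {G H : Dag V} (hG : G.IsAncestral A)
    (hH : H.IsAncestral A) {v : V} (hv : v ∈ A) :
    ((H.induce A).insertion G hG).parents v = H.parents v := by
  ext u
  refine (insertion_adj_of_mem _ _ hG hv).trans ?_
  exact ⟨fun h => h.2, fun h => ⟨hH v hv h, h⟩⟩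

theorem parents_insertion_of_notMem {A : Set V} (H : Dag A) {G : Dag V} (hG : G.IsAncestral A)
    {v : V} (hv : v ∉ A) : (H.insertion G hG).parents v = G.parents v := by
  ext u
  exact insertion_adj_of_notMem H G hG hv

theorem joined_insertion_iff {A : Set V} (H : Dag A) (G : Dag V) (hA : G.IsAncestral A)
    (u v : V) : (H.insertion G hA).Joined u v ↔
      (∃ (hu : u ∈ A) (hv : v ∈ A), H.Joined ⟨u, hu⟩ ⟨v, hv⟩) ∨
        (G.Joined u v ∧ ¬ (u ∈ A ∧ v ∈ A)) := by
  simp only [Joined, insertion]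
  by_cases hu : u ∈ A <;> by_cases hv : v ∈ A <;> simp [hu, hv]

theorem SamePattern.induce {G G' : Dag V} (h : G.SamePattern G') (A : Set V) :
    (G.induce A).SamePattern (G'.induce A) := by
  refine ⟨fun u v => h.1 u v, fun u w v => ?_⟩
  have := h.2 u w v
  simp only [Immorality, Joined, ne_eq, Subtype.ext_iff, Dag.induce] at this ⊢
  exact this

theorem SamePattern.immorality_insertion {A : Set V} {H H' : Dag A} {G G' : Dag V}
    (hA : G.IsAncestral A) (hA' : G'.IsAncestral A) (hH : H.SamePattern H')
    (hG : G.SamePattern G') (hj : ∀ u v, (H.insertion G hA).Joined u v ↔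
      (H'.insertion G' hA').Joined u v) {u w v : V} (h : (H.insertion G hA).Immorality u w v) :
    (H'.insertion G' hA').Immorality u w v := by
  obtain ⟨huw, hvw, hne, hn⟩ := h
  rw [hj] at hn
  by_cases hw : w ∈ A
  · rw [insertion_adj_of_mem _ _ _ hw] at huw hvw
    obtain ⟨hu, huw⟩ := huw
    obtain ⟨hv, hvw⟩ := hvw
    have hn' : ¬ H.Joined ⟨u, hu⟩ ⟨v, hv⟩ := fun h' =>
      hn ((joined_insertion_iff _ _ _ _ _).2 (Or.inl ⟨hu, hv, (hH.1 _ _).1 h'⟩))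
    obtain ⟨h₁, h₂, -⟩ := (hH.2 ⟨u, hu⟩ ⟨w, hw⟩ ⟨v, hv⟩).1
      ⟨huw, hvw, fun h => hne (congrArg Subtype.val h), hn'⟩
    exact ⟨(insertion_adj_of_mem _ _ _ hw).2 ⟨hu, h₁⟩, (insertion_adj_of_mem _ _ _ hw).2 ⟨hv, h₂⟩,
      hne, hn⟩
  · rw [insertion_adj_of_notMem _ _ _ hw] at huw hvw
    refine ⟨?_, ?_, hne, hn⟩ <;> rw [insertion_adj_of_notMem _ _ _ hw] <;>
      -- If both parents lie in `A`, they may be joined in `G`, so no immorality of `G` is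
      -- available; but an arrow from `w ∉ A` into `A` is impossible, which fixes the direction.
      by_cases huv : u ∈ A ∧ v ∈ A
    · exact ((hG.1 u w).1 (Or.inl huw)).resolve_right fun h => hw (hA' u huv.1 h)
    · have hn' : ¬ G.Joined u v := fun h' =>
        hn ((joined_insertion_iff _ _ _ _ _).2 (Or.inr ⟨(hG.1 _ _).1 h', huv⟩))
      exact ((hG.2 u w v).1 ⟨huw, hvw, hne, hn'⟩).1
    · exact ((hG.1 v w).1 (Or.inl hvw)).resolve_right fun h => hw (hA' v huv.2 h)
    · have hn' : ¬ G.Joined u v := fun h' =>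
        hn ((joined_insertion_iff _ _ _ _ _).2 (Or.inr ⟨(hG.1 _ _).1 h', huv⟩))
      exact ((hG.2 u w v).1 ⟨huw, hvw, hne, hn'⟩).2.1

theorem SamePattern.insertion {A : Set V} {H H' : Dag A} {G G' : Dag V}
    (hA : G.IsAncestral A) (hA' : G'.IsAncestral A) (hH : H.SamePattern H')
    (hG : G.SamePattern G') : (H.insertion G hA).SamePattern (H'.insertion G' hA') := by
  have hj : ∀ u v, (H.insertion G hA).Joined u v ↔ (H'.insertion G' hA').Joined u v := by
    intro u v
    simp only [joined_insertion_iff, hH.1, hG.1]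
  exact ⟨hj, fun u w v => ⟨immorality_insertion hA hA' hH hG hj,
    immorality_insertion hA' hA hH.symm hG.symm fun u v => (hj u v).symm⟩⟩

/-- The DAG that is complete on `A` and in which all other vertices are isolated. -/
def completeOn (A : Set V) : Dag V where
  Adj u v := u ∈ A ∧ v ∈ A ∧ WellOrderingRel u v
  acyclic := ⟨WellOrderingRel, inferInstance, fun _ _ h => h.2.2⟩

theorem joined_completeOn_iff (A : Set V) (u v : V) :
    (completeOn A).Joined u v ↔ u ≠ v ∧ u ∈ A ∧ v ∈ A := by
  constructor
  · intro h
    refine ⟨?_, ?_⟩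
    · rintro rfl
      exact (completeOn A).irrefl u (h.elim id id)
    · rcases h with h | h
      exacts [⟨h.1, h.2.1⟩, ⟨h.2.1, h.1⟩]
  · rintro ⟨hne, hu, hv⟩
    rcases trichotomous_of WellOrderingRel u v with h | h | h
    · exact Or.inl ⟨hu, hv, h⟩
    · exact absurd h hne
    · exact Or.inr ⟨hv, hu, h⟩

theorem not_immorality_of_joined_iff {G : Dag V} {A : Set V}
    (hG : ∀ u v, G.Joined u v ↔ u ≠ v ∧ u ∈ A ∧ v ∈ A) (u w v : V) : ¬ G.Immorality u w v :=
  fun ⟨h₁, h₂, hne, hn⟩ =>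
    hn ((hG u v).2 ⟨hne, ((hG u w).1 (Or.inl h₁)).2.1, ((hG v w).1 (Or.inl h₂)).2.1⟩)

theorem samePattern_completeOn {G : Dag V} {A : Set V}
    (hG : ∀ u v, G.Joined u v ↔ u ≠ v ∧ u ∈ A ∧ v ∈ A) : G.SamePattern (completeOn A) :=
  ⟨fun u v => (hG u v).trans (joined_completeOn_iff A u v).symm, fun u w v =>
    iff_of_false (not_immorality_of_joined_iff hG u w v)
      (not_immorality_of_joined_iff (joined_completeOn_iff A) u w v)⟩

theorem completeOn_of_subsingleton {A : Set V} (hA : A.Subsingleton) :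
    completeOn A = completeOn ∅ := by
  refine ext_adj fun u v => ⟨?_, fun h => absurd h.1 (Set.notMem_empty u)⟩
  rintro ⟨hu, hv, h⟩
  exact absurd (hA hu hv ▸ h) (irrefl_of WellOrderingRel u)

instance [Finite V] : Finite (Dag V) :=
  Finite.of_injective (fun G : Dag V => G.Adj) fun _ _ h =>
    ext_adj fun u v => iff_of_eq (congrFun (congrFun h u) v)

end Dag

/-! ### Splitting and recombining dagoids -/

namespace Dagoid

variable {V : Type*}

instance [Finite V] : Finite (Dagoid V) := inferInstanceAs (Finite (Quotient (Dag.markovSetoid V)))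

instance : DiscreteMeasurableSpace (Dagoid V) := ⟨fun _ => trivial⟩

theorem mk_eq_mk_iff [Finite V] {G H : Dag V} : mk G = mk H ↔ G.SamePattern H :=
  Quotient.eq.trans Dag.equiv_iff_samePattern

theorem dCliqueVector_mk [Fintype V] (G : Dag V) : (mk G).dCliqueVector = G.dCliqueVector :=
  Dag.dCliqueVector_eq_of_equiv (Quotient.mk_out G)

theorem mk_rep {A : Set V} (D : ances A) : mk (rep D) = D.1 := D.2.choose_spec.1

theorem mk_mem_ances {A : Set V} {G : Dag V} (hG : G.IsAncestral A) : mk G ∈ ances A :=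
  ⟨G, rfl, hG⟩

theorem induced_mk [Finite V] {A : Set V} {G : Dag V} (hG : G.IsAncestral A) :
    induced ⟨mk G, mk_mem_ances hG⟩ = mk (G.induce A) :=
  mk_eq_mk_iff.2 ((mk_eq_mk_iff.1 (mk_rep ⟨mk G, mk_mem_ances hG⟩)).induce A)

theorem mk_insertion_congr [Finite V] {A : Set V} {H H' : Dag A} {G G' : Dag V}
    (hA : G.IsAncestral A) (hA' : G'.IsAncestral A) (hH : mk H = mk H') (hG : mk G = mk G') :
    mk (H.insertion G hA) = mk (H'.insertion G' hA') :=
  mk_eq_mk_iff.2 (.insertion hA hA' (mk_eq_mk_iff.1 hH) (mk_eq_mk_iff.1 hG))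

theorem remainder_mk [Finite V] {A : Set V} {G : Dag V} (hG : G.IsAncestral A) :
    remainder ⟨mk G, mk_mem_ances hG⟩ = mk ((Dag.complete A).insertion G hG) :=
  mk_insertion_congr _ _ rfl (mk_rep ⟨mk G, mk_mem_ances hG⟩)

/-- The dagoid with the remainder of `D` and the subdagoid of `D'` on an ancestral set. -/
noncomputable def splice {A : Set V} (D D' : ances A) : ances A :=
  ⟨mk (((rep D').induce A).insertion (rep D) (isAncestral_rep D)),
    mk_mem_ances (Dag.isAncestral_insertion _ _ _)⟩

theorem remainder_splice [Finite V] {A : Set V} (D D' : ances A) :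
    remainder (splice D D') = remainder D := by
  rw [splice, remainder_mk (Dag.isAncestral_insertion _ _ _), Dag.insertion_insertion]
  rfl

theorem induced_splice [Finite V] {A : Set V} (D D' : ances A) :
    induced (splice D D') = induced D' := by
  rw [splice, induced_mk (Dag.isAncestral_insertion _ _ _), Dag.induce_insertion]
  rfl

/-- Inserting `D_A` into `D_{V|A}` recovers `D`. -/
theorem eq_of_remainder_eq_of_induced_eq [Finite V] {A : Set V} {D D' : ances A}
    (hr : remainder D = remainder D') (hi : induced D = induced D') : D = D' := by
  have key := mk_insertion_congr (Dag.isAncestral_insertion (Dag.complete A) _ (isAncestral_rep D))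
    (Dag.isAncestral_insertion (Dag.complete A) _ (isAncestral_rep D')) hi hr
  rw [Dag.insertion_insertion, Dag.insertion_insertion, Dag.insertion_induce_self,
    Dag.insertion_induce_self, mk_rep, mk_rep] at key
  exact Subtype.ext key

theorem splice_mk [Finite V] {A : Set V} {G G' : Dag V} (hG : G.IsAncestral A)
    (hG' : G'.IsAncestral A) :
    (splice ⟨mk G, mk_mem_ances hG⟩ ⟨mk G', mk_mem_ances hG'⟩).1 =
      mk ((G'.induce A).insertion G hG) :=
  mk_insertion_congr _ _ (induced_mk hG') (mk_rep _)

end Dagoid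

/-! ### Independence as a cross-product relation -/

section Independence

open MeasureTheory ProbabilityTheory

variable {X Y Z : Type*} [MeasurableSpace X] [DiscreteMeasurableSpace X] [MeasurableSpace Y]
  [DiscreteMeasurableSpace Y] [MeasurableSpace Z] [DiscreteMeasurableSpace Z]

/-- If points are determined by their values under `f` and `g`, and the values of `f` and `g` can be
combined freely by means of `σ`, then `f` and `g` are independent under a probability measure on a
finite space iff the masses of points satisfy the cross-product relation. -/
theorem indepFun_iff_cross_mul [Finite X] (μ : Measure X) [IsProbabilityMeasure μ] {f : X → Y}
    {g : X → Z} {σ : X → X → X} (hf : ∀ x x', f (σ x x') = f x) (hg : ∀ x x', g (σ x x') = g x')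
    (hinj : ∀ x x', f x = f x' → g x = g x' → x = x') :
    IndepFun f g μ ↔ ∀ x x', μ {x} * μ {x'} = μ {σ x x'} * μ {σ x' x} := by
  classical
  rw [indepFun_iff_measure_inter_preimage_eq_mul]
  constructor
  · intro h x x'
    have key : ∀ z, μ {z} = μ (f ⁻¹' {f z}) * μ (g ⁻¹' {g z}) := by
      intro z
      rw [← h _ _ (.of_discrete) (.of_discrete)]
      congr 1
      ext w
      exact ⟨by rintro rfl; exact ⟨rfl, rfl⟩, fun hw => hinj w z hw.1 hw.2⟩
    rw [key x, key x', key (σ x x'), key (σ x' x), hf, hf, hg, hg]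
    ring
  · intro h s t _ _
    have := Fintype.ofFinite X
    have hsum : ∀ S : Set X, μ S = ∑ x with x ∈ S, μ {x} := by
      intro S
      rw [sum_measure_singleton]
      simp
    have hinv : ∀ x x', σ (σ x x') (σ x' x) = x := fun x x' =>
      hinj _ _ (by rw [hf, hf]) (by rw [hg, hg])
    -- Writing `1` as the total mass turns both sides into sums over pairs of points, matched by the
    -- involution `(x, x') ↦ (σ x x', σ x' x)`.
    rw [← mul_one (μ (f ⁻¹' s ∩ g ⁻¹' t)), ← measure_univ (μ := μ), hsum, hsum Set.univ,
      hsum (f ⁻¹' s), hsum (g ⁻¹' t), Finset.sum_mul_sum, Finset.sum_mul_sum,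
      ← Finset.sum_product', ← Finset.sum_product']
    refine Finset.sum_nbij' (fun p => (σ p.1 p.2, σ p.2 p.1)) (fun p => (σ p.1 p.2, σ p.2 p.1))
      ?_ ?_ ?_ ?_ ?_
    · rintro ⟨x, x'⟩ hx
      simpa [hf, hg] using hx
    · rintro ⟨x, x'⟩ hx
      simpa [hf, hg] using hx
    · rintro ⟨x, x'⟩ -
      simp [hinv]
    · rintro ⟨x, x'⟩ -
      simp [hinv]
    · rintro ⟨x, x'⟩ -
      exact h x x'

end Independence

/-! ### The exponent, and the cross-product form of the Markov property -/

namespace Dag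

variable {V : Type*}

open Classical in
theorem sum_mul_dCliqueVector [Fintype V] (ω : Set V → ℝ) (G : Dag V) :
    ∑ A, ω A * (G.dCliqueVector A : ℝ) =
      ∑ v, (ω (insert v (G.parents v)) - ω (G.parents v)) + ω ∅ := by
  have hsingle : ∀ B : Set V, ∑ A, ω A * ((Pi.single B (1 : ℤ) : Set V → ℤ) A : ℝ) = ω B := by
    intro B
    rw [Finset.sum_eq_single B] <;> simp +contextual
  simp only [dCliqueVector, Pi.add_apply, Finset.sum_apply, Pi.sub_apply, Int.cast_add,
    Int.cast_sum, Int.cast_sub, mul_add, Finset.mul_sum, mul_sub, Finset.sum_add_distrib, hsingle]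
  rw [Finset.sum_comm]
  simp only [Finset.sum_sub_distrib, hsingle]

/-- An exchange of the subgraphs on a common ancestral set preserves the total of any function of
the vertices and their parents. -/
theorem sum_parents_insertion_add [Fintype V] {M : Type*} [AddCommMonoid M] (F : V → Set V → M)
    {A : Set V} {G H : Dag V} (hG : G.IsAncestral A) (hH : H.IsAncestral A) :
    ∑ v, F v (G.parents v) + ∑ v, F v (H.parents v) =
      ∑ v, F v (((H.induce A).insertion G hG).parents v) +
        ∑ v, F v (((G.induce A).insertion H hH).parents v) := by
  rw [← Finset.sum_add_distrib, ← Finset.sum_add_distrib]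
  refine Finset.sum_congr rfl fun v _ => ?_
  by_cases hv : v ∈ A
  · rw [parents_insertion_induce_of_mem hG hH hv, parents_insertion_induce_of_mem hH hG hv,
      add_comm]
  · rw [parents_insertion_of_notMem _ hG hv, parents_insertion_of_notMem _ hH hv]

theorem isAncestral_completeOn_compl_singleton {P : Set V} {v : V} (hv : v ∉ P) :
    (completeOn P).IsAncestral {v}ᶜ := by
  rintro w - u ⟨hu, -⟩ rfl
  exact hv hu

end Dag

-- Remainder and induced dagoid determine a dagoid and combine freely, so the independence criterion
-- applies with `Dagoid.splice`; the normalising constants cancel.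
open MeasureTheory ProbabilityTheory in
theorem isStructurallyMarkov_iff_cross_mul {V : Type*} [Finite V] {law : PMF (Dagoid V)}
    (hsupp : law.support = Set.univ) :
    IsStructurallyMarkov law ↔ ∀ (A : Set V) (G H : Dag V) (hG : G.IsAncestral A)
      (hH : H.IsAncestral A), law (.mk G) * law (.mk H) =
        law (.mk ((H.induce A).insertion G hG)) * law (.mk ((G.induce A).insertion H hH)) := by
  refine forall_congr' fun A => ?_
  have hne : (Dagoid.ances A).Nonempty :=
    ⟨_, Dagoid.mk_mem_ances (G := Dag.completeOn ∅) fun v _ u hu => absurd hu.1 (by simp)⟩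
  have h0 : law.toMeasure (Dagoid.ances A) ≠ 0 := by
    rw [Ne, PMF.toMeasure_apply_eq_zero_iff _ .of_discrete, hsupp, Set.univ_disjoint]
    exact hne.ne_empty
  have htop : law.toMeasure (Dagoid.ances A) ≠ ⊤ := measure_ne_top _ _
  set μ := (law.toMeasure[|Dagoid.ances A]).comap (Subtype.val : Dagoid.ances A → Dagoid V)
  have hμ : ∀ S : Set (Dagoid.ances A),
      μ S = (law.toMeasure (Dagoid.ances A))⁻¹ * law.toMeasure (Subtype.val '' S) := by
    intro S
    rw [Measure.comap_apply _ Subtype.val_injective (fun _ _ => .of_discrete) _ .of_discrete,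
      cond_apply .of_discrete, Set.inter_eq_right.2]
    rintro _ ⟨D, -, rfl⟩
    exact D.2
  have hμp : IsProbabilityMeasure μ := by
    refine ⟨?_⟩
    rw [hμ, Set.image_univ, Subtype.range_val, ENNReal.inv_mul_cancel h0 htop]
  have hμs : ∀ D, μ {D} = (law.toMeasure (Dagoid.ances A))⁻¹ * law D.1 := by
    intro D
    rw [hμ, Set.image_singleton, PMF.toMeasure_apply_singleton _ _ .of_discrete]
  rw [indepFun_iff_cross_mul μ Dagoid.remainder_splice Dagoid.induced_splice
    fun D D' => Dagoid.eq_of_remainder_eq_of_induced_eq]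
  have hcancel : ∀ a b c d : ENNReal, (law.toMeasure (Dagoid.ances A))⁻¹ * a *
      ((law.toMeasure (Dagoid.ances A))⁻¹ * b) = (law.toMeasure (Dagoid.ances A))⁻¹ * c *
      ((law.toMeasure (Dagoid.ances A))⁻¹ * d) ↔ a * b = c * d := by
    intro a b c d
    rw [mul_mul_mul_comm, mul_mul_mul_comm _ c]
    exact ENNReal.mul_right_inj (mul_ne_zero (ENNReal.inv_ne_zero.2 htop)
      (ENNReal.inv_ne_zero.2 htop)) (ENNReal.mul_ne_top (ENNReal.inv_ne_top.2 h0)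
      (ENNReal.inv_ne_top.2 h0))
  simp only [hμs, hcancel]
  constructor
  · intro h G H hG hH
    have := h ⟨_, Dagoid.mk_mem_ances hG⟩ ⟨_, Dagoid.mk_mem_ances hH⟩
    rwa [Dagoid.splice_mk hG hH, Dagoid.splice_mk hH hG] at this
  · intro h D D'
    have := h _ _ (Dagoid.isAncestral_rep D) (Dagoid.isAncestral_rep D')
    rwa [Dagoid.mk_rep, Dagoid.mk_rep] at this

/-! ### The logarithm of a structurally Markov law -/

section LogLaw

variable {V : Type*} [Fintype V] {law : PMF (Dagoid V)}

/-- The effect on a structurally Markov law of the removal of the arrows into a vertex `v` without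
children. -/
theorem IsStructurallyMarkov.log_law_eq (h : IsStructurallyMarkov law)
    (hsupp : law.support = Set.univ) {G : Dag V} {v : V} (hv : ∀ w, ¬ G.Adj v w) :
    ∃ H : Dag V, H.parents v = ∅ ∧ (∀ w, w ≠ v → H.parents w = G.parents w) ∧
      Real.log (law (.mk G)).toReal = Real.log (law (.mk H)).toReal +
        (Real.log (law (.mk (.completeOn (insert v (G.parents v))))).toReal -
          Real.log (law (.mk (.completeOn (G.parents v)))).toReal) := by
  have hpos : ∀ D, (law D).toReal ≠ 0 := fun D =>
    (ENNReal.toReal_pos (by simpa using hsupp.ge (Set.mem_univ D)) (law.apply_ne_top D)).ne'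
  have hG : G.IsAncestral {v}ᶜ := by
    rintro w - u hu rfl
    exact hv w hu
  have hvp : v ∉ G.parents v := G.irrefl v
  have hK := Dag.isAncestral_completeOn_compl_singleton hvp
  have hvA : v ∉ ({v}ᶜ : Set V) := by simp
  refine ⟨(G.induce {v}ᶜ).insertion (.completeOn (G.parents v)) hK, ?_, fun w hw =>
    Dag.parents_insertion_induce_of_mem hK hG hw, ?_⟩
  · rw [Dag.parents_insertion_of_notMem _ hK hvA]
    exact Set.eq_empty_of_forall_notMem fun u hu => G.irrefl v hu.2.1
  have key := congrArg (fun x => Real.log x.toReal)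
    ((isStructurallyMarkov_iff_cross_mul hsupp).1 h _ _ _ hG hK)
  -- The two DAGs may be oriented differently, so only their patterns are compared.
  have hmk : Dagoid.mk (((Dag.completeOn (G.parents v)).induce {v}ᶜ).insertion G hG) =
      .mk (.completeOn (insert v (G.parents v))) := by
    refine Dagoid.mk_eq_mk_iff.2 (Dag.samePattern_completeOn fun u w => ?_)
    have hpv : ∀ u, (((Dag.completeOn (G.parents v)).induce {v}ᶜ).insertion G hG).Adj u v ↔
        u ∈ G.parents v := fun u => Dag.insertion_adj_of_notMem _ _ hG hvA
    have hpw : ∀ u w, w ≠ v →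
        ((((Dag.completeOn (G.parents v)).induce {v}ᶜ).insertion G hG).Adj u w ↔
          (Dag.completeOn (G.parents v)).Adj u w) := fun u w hw =>
      Set.ext_iff.1 (Dag.parents_insertion_induce_of_mem hG hK hw) u
    have hvK : ∀ w, ¬ (Dag.completeOn (G.parents v)).Adj v w := fun w h => hvp h.1
    by_cases hu : u = v <;> by_cases hw : w = v
    · subst hu hw
      simp [Dag.Joined, hpv, hvp]
    · subst hu
      simp [Dag.Joined, hpv, hpw _ _ hw, hvK, hw, Ne.symm hw]
    · subst hw
      simp [Dag.Joined, hpv, hpw _ _ hu, hvK, hu]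
    · have := Dag.joined_completeOn_iff (G.parents v) u w
      rw [Dag.Joined, hpw _ _ hw, hpw _ _ hu]
      simpa [hu, hw, Dag.Joined] using this
  rw [hmk] at key
  simp only [ENNReal.toReal_mul] at key
  rw [Real.log_mul (hpos _) (hpos _), Real.log_mul (hpos _) (hpos _)] at key
  linarith

theorem IsStructurallyMarkov.log_law_eq_sum (h : IsStructurallyMarkov law)
    (hsupp : law.support = Set.univ) (G : Dag V) :
    Real.log (law (.mk G)).toReal =
      ∑ v, (Real.log (law (.mk (.completeOn (insert v (G.parents v))))).toReal -
        Real.log (law (.mk (.completeOn (G.parents v)))).toReal) +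
          Real.log (law (.mk (.completeOn ∅))).toReal := by
  classical
  -- Hence a vertex without parents contributes zero to the sum.
  have hsing : ∀ v : V, Dag.completeOn (insert v (∅ : Set V)) = .completeOn ∅ := fun v =>
    Dag.completeOn_of_subsingleton (by simp)
  induction hn : {v | (G.parents v).Nonempty}.ncard using Nat.strong_induction_on
    generalizing G with
  | _ n ih =>
    rcases Set.eq_empty_or_nonempty {v | (G.parents v).Nonempty} with he | hne
    · have hp : ∀ v, G.parents v = ∅ := fun v =>
        Set.not_nonempty_iff_eq_empty.1 fun hv => (Set.ext_iff.1 he v).1 hv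
      have hG : G = .completeOn ∅ := Dag.ext_parents fun v => by
        rw [hp]
        exact (Set.eq_empty_of_forall_notMem fun u hu => hu.1).symm
      simp only [hp, hsing, sub_self, Finset.sum_const_zero, zero_add]
      rw [hG]
    · obtain ⟨f, hf⟩ := G.exists_rank
      -- The last vertex that has parents is childless, since a child of it would be a later such
      -- vertex.
      obtain ⟨v, hv, hmax⟩ := Set.exists_max_image _ f (Set.toFinite _) hne
      obtain ⟨H, hHv, hH, hlog⟩ := h.log_law_eq hsupp (G := G) (v := v) fun w hw =>
        not_lt.2 (hmax w ⟨v, hw⟩) (hf _ _ hw)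
      have hlt : {w | (H.parents w).Nonempty}.ncard < n := by
        rw [← hn]
        refine Set.ncard_lt_ncard ⟨fun w hw => ?_, fun hs => ?_⟩ (Set.toFinite _)
        · by_cases hwv : w = v
          · exact hwv ▸ hv
          · have : (H.parents w).Nonempty := hw
            rwa [hH w hwv] at this
        · have : (H.parents v).Nonempty := hs hv
          simp [hHv] at this
      rw [hlog, ih _ hlt H rfl, ← Finset.add_sum_erase _ _ (Finset.mem_univ v),
        ← Finset.add_sum_erase _ _ (Finset.mem_univ v), hHv, hsing,
        Finset.sum_congr rfl fun w hw => by rw [hH w (Finset.ne_of_mem_erase hw)]]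
      ring

end LogLaw

theorem mainTheorem2 {V : Type*} [Fintype V] (law : PMF (Dagoid V))
    (hsupp : law.support = Set.univ) :
    IsStructurallyMarkov law ↔ IsDCliqueExponential law := by
  constructor
  · intro h
    -- The coordinate of `t` at `∅` absorbs the normalisation, so the constant is `1`.
    refine ⟨fun A => Real.log (law (.mk (.completeOn A))).toReal, 1, one_pos, fun D => ?_⟩
    have hpos : 0 < (law D).toReal :=
      ENNReal.toReal_pos (by simpa using hsupp.ge (Set.mem_univ D)) (law.apply_ne_top D)
    have hD : Dagoid.mk (Quotient.out D) = D := Quotient.out_eq D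
    have hlog := h.log_law_eq_sum hsupp (Quotient.out D)
    rw [hD] at hlog
    rw [Dagoid.dCliqueVector, Dag.sum_mul_dCliqueVector, ← hlog, Real.exp_log hpos, one_mul]
  · rintro ⟨ω, c, -, hlaw⟩
    rw [isStructurallyMarkov_iff_cross_mul hsupp]
    intro A G H hG hH
    rw [← ENNReal.toReal_eq_toReal_iff'
      (ENNReal.mul_ne_top (law.apply_ne_top _) (law.apply_ne_top _))
      (ENNReal.mul_ne_top (law.apply_ne_top _) (law.apply_ne_top _))]
    have hsum := Dag.sum_parents_insertion_add (fun v P => ω (insert v P) - ω P) hG hH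
    simp only [ENNReal.toReal_mul, hlaw, Dagoid.dCliqueVector_mk, Dag.sum_mul_dCliqueVector]
    rw [mul_mul_mul_comm, mul_mul_mul_comm c (Real.exp _) c, ← Real.exp_add, ← Real.exp_add]
    congr 2
    linarith
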